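/- **Setting.** An instance of the *graph orientation problem with arbitrary query costs* is a finite simple graph $G=(V,E)$ with a query cost $c_v\ge 0$ for every $v\in V$ and, for every $v\in V$, an atomless probability distribution $d_v$ on $\mathbb R$ whose uncertainty interval is $I_v=(\ell_v,r_v)$, where $\ell_v$ is the largest real number with $\mathbb P[w_v\le \ell_v]=0$ and $r_v$ the smallest with $\mathbb P[w_v\ge r_v]=0$. The weights $w_v$ are drawn independently from the $d_v$. It is assumed that $I_u\cap I_v\ne\emptyset$ for every edge $\{u,v\}$. Write $c(S)=\sum_{v\in S}c_v$. A set $Q\subseteq V$ is a *feasible query set* for a realization $w\in\prod_v I_v$ if the values $w_q$, $q\in Q$, suffice to identify a minimum-weight endpoint of every edge, i.e. for every edge one and the same endpoint has minimum weight in all realizations $w'\in\prod_v I_v$ that agree with $w$ on $Q$. Let $\mathrm{OPT}$ be the minimum cost of a feasible query set for the random realization. A vertex is *mandatory* if it belongs to every feasible query set; $p_v$ is the probability that $v$ is mandatory. **Algorithm Threshold** (parameter $d\in(0,1]$, and an $\alpha$-approximation for weighted vertex cover, $1\le\alpha\le2$): 1. Let $M=\{v\in V: p_v\ge d\}$. 2.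 Let $x^*$ be an optimal basic feasible solution of the linear program: minimize $\sum_v c_vx_v$ subject to $x_u+x_v\ge1$ for every edge $\{u,v\}$ and $x_v\ge0$ for every vertex $v$ of $G[V\setminus M]$. Let $V_1=\{v: x^*_v=1\}$ and $V_{1/2}=\{v:x^*_v=\tfrac12\}$. 3. Let $VC'$ be the vertex cover of $G[V_{1/2}]$ returned by the approximation, so that $c(VC')\le\alpha\, c(C)$ for every vertex cover $C$ of $G[V_{1/2}]$. 4. Query $Q=M\cup V_1\cup VC'$, and then the mandatory vertices of $V\setminus Q$. The competitive ratio of Threshold is the supremum of $\mathbb E[\mathrm{ALG}]/\mathbb E[\mathrm{OPT}]$ over all instances, all choices of $x^*$ and all answers $VC'$, where $\mathrm{ALG}$ is the total cost of the vertices queried (with $0/0=0$ and $a/0=\infty$ for $a>0$). **Theorem.** Let $1\le\alpha\le2$. (i) For every $d\in(0,1]$, every instance and every choice of $x^*$ and $VC'$ (such choices exist), Threshold queries a feasible query set for every realization $w\in\prod_v I_v$, the set queried last depends only on the weights revealed by querying $Q$, and $$\mathbb E[\mathrm{ALG}]\le\max\Bigl\{\tfrac1d,\ \alpha+(2-\alpha)d\Bigr\}\cdot\mathbb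 E[\mathrm{OPT}].$$ Hence the competitive ratio of Threshold is at most $\max\{\frac1d,\alpha+(2-\alpha)d\}$. (ii) The parameter $d(\alpha)=2/\bigl(\alpha+\sqrt{8-\alpha(4-\alpha)}\bigr)$ lies in $(0,1]$ and minimizes $\max\{\frac1d,\alpha+(2-\alpha)d\}$ over $d\in(0,1]$; the minimum is $\frac12\bigl(\alpha+\sqrt{8-\alpha(4-\alpha)}\bigr)$, so that Threshold with $d=d(\alpha)$ has competitive ratio at most $\frac12\bigl(\alpha+\sqrt{8-\alpha(4-\alpha)}\bigr)$. (iii) The value $\frac12\bigl(\alpha+\sqrt{8-\alpha(4-\alpha)}\bigr)$ lies between the golden ratio $\phi=\frac{1+\sqrt5}2$ and $2$; it equals $\phi$ for $\alpha=1$ and $2$ for $\alpha=2$. -/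

import Mathlib

open MeasureTheory Set
open scoped ENNReal

universe u

noncomputable section

/-- An instance of the graph orientation problem with arbitrary query costs.  Every vertex `v` has a
query cost and an unknown weight drawn, independently of the others, from a known atomless
distribution `dist v`; the uncertainty interval of `v` is the open interval `(left v, right v)`. -/
structure OrientationInstance (V : Type*) [Fintype V] where
  graph : SimpleGraph V
  cost : V → ℝ
  cost_nonneg : ∀ v, 0 ≤ cost v
  dist : V → Measure ℝ
  isProbabilityMeasure_dist : ∀ v, IsProbabilityMeasure (dist v)
  dist_singleton : ∀ v t, dist v {t} = 0
  left : V → ℝ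
  right : V → ℝ
  /-- `left v` is the largest value that the weight of `v` almost surely exceeds. -/
  left_isGreatest : ∀ v, IsGreatest {t : ℝ | dist v (Iic t) = 0} (left v)
  /-- `right v` is the smallest value that almost surely exceeds the weight of `v`. -/
  right_isLeast : ∀ v, IsLeast {t : ℝ | dist v (Ici t) = 0} (right v)
  /-- An edge between disjoint intervals is oriented from the start, so it is no edge of the
  instance. -/
  overlap : ∀ u v, graph.Adj u v →
    (Ioo (left u) (right u) ∩ Ioo (left v) (right v)).Nonempty

namespace OrientationInstance

variable {V : Type*} [Fintype V] (I : OrientationInstance V)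

instance (v : V) : IsProbabilityMeasure (I.dist v) := I.isProbabilityMeasure_dist v

/-- The uncertainty interval of a vertex. -/
def interval (v : V) : Set ℝ := Ioo (I.left v) (I.right v)

/-- A realization assigns to every vertex a weight in its uncertainty interval. -/
def IsRealization (w : V → ℝ) : Prop := ∀ v, w v ∈ I.interval v

/-- The law of the (random) realization: the weights are independent. -/
def law : Measure (V → ℝ) := Measure.pi I.dist

/-- The total query cost `c(S)` of a set of vertices. -/
def totalCost (S : Finset V) : ℝ := ∑ v ∈ S, I.cost v

/-- `Q` is a feasible query set for `w`: the revealed weights of the vertices in `Q` permit one to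
identify a minimum-weight endpoint of every edge, that is, one and the same endpoint has minimum
weight in all realizations that agree with `w` on `Q`. -/
def Feasible (w : V → ℝ) (Q : Finset V) : Prop :=
  ∀ u v, I.graph.Adj u v →
    (∀ w', I.IsRealization w' → (∀ q ∈ Q, w' q = w q) → w' u ≤ w' v) ∨
    (∀ w', I.IsRealization w' → (∀ q ∈ Q, w' q = w q) → w' v ≤ w' u)

/-- The optimal query cost for `w`: the minimum cost of a feasible query set. -/
def opt (w : V → ℝ) : ℝ := sInf (I.totalCost '' {Q | I.Feasible w Q})

/-- A vertex is mandatory for `w` if it belongs to every feasible query set. -/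
def Mandatory (w : V → ℝ) (v : V) : Prop := ∀ Q, I.Feasible w Q → v ∈ Q

/-- The probability `p_v` that `v` is mandatory. -/
def mandatoryProb (v : V) : ℝ := I.law.real {w | I.Mandatory w v}

/-- The set `M` of the vertices that are mandatory with probability at least `d`. -/
def likelyMandatory (d : ℝ) : Set V := {v | d ≤ I.mandatoryProb v}

/-- Querying all vertices is always feasible. -/
theorem feasible_univ (w : V → ℝ) : I.Feasible w Finset.univ := by
  intro u v _
  rcases le_total (w u) (w v) with h | h
  · refine Or.inl fun w' _ h' => ?_
    rwa [h' u (Finset.mem_univ u), h' v (Finset.mem_univ v)]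
  · refine Or.inr fun w' _ h' => ?_
    rwa [h' u (Finset.mem_univ u), h' v (Finset.mem_univ v)]

end OrientationInstance

/-- The feasible region of the linear programming relaxation of vertex cover. -/
def vertexCoverPolyhedron {W : Type*} (H : SimpleGraph W) : Set (W → ℝ) :=
  {x | (∀ u v, H.Adj u v → 1 ≤ x u + x v) ∧ ∀ v, 0 ≤ x v}

/-- `x` is an optimal basic feasible solution (an optimal vertex of the feasible region) of the
vertex cover relaxation on `H` with weights `c`. -/
structure IsOptimalBasicSolution {W : Type*} [Fintype W] (H : SimpleGraph W) (c : W → ℝ)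
    (x : W → ℝ) : Prop where
  basic : x ∈ (vertexCoverPolyhedron H).extremePoints ℝ
  optimal : ∀ y ∈ vertexCoverPolyhedron H, ∑ v, c v * x v ≤ ∑ v, c v * y v

/-- `C` is a vertex cover of `H` whose weight is at most `α` times the weight of any vertex
cover. -/
structure IsApproxVertexCover {W : Type*} (α : ℝ) (H : SimpleGraph W) (c : W → ℝ)
    (C : Finset W) : Prop where
  isVertexCover : H.IsVertexCover (C : Set W)
  approx : ∀ C' : Finset W, H.IsVertexCover (C' : Set W) → ∑ v ∈ C, c v ≤ α * ∑ v ∈ C', c v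

open Classical in
/-- An execution of the algorithm Threshold with parameter `d` and an `α`-approximation for vertex
cover: the answer `x` of the linear programming solver on `G[V ∖ M]` and the answer `cover` of the
vertex cover black box on `G[V_{1/2}]`, both with the query costs as weights. -/
structure ThresholdRun {V : Type*} [Fintype V] (I : OrientationInstance V) (α d : ℝ) where
  x : ((I.likelyMandatory d)ᶜ : Set V) → ℝ
  x_spec : IsOptimalBasicSolution (I.graph.induce (I.likelyMandatory d)ᶜ) (fun v => I.cost v) x
  cover : Finset (Subtype.val '' {v | x v = 1 / 2} : Set V)
  cover_spec : IsApproxVertexCover α (I.graph.induce (Subtype.val '' {v | x v = 1 / 2}))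
    (fun v => I.cost v) cover

namespace ThresholdRun

variable {V : Type*} [Fintype V] {I : OrientationInstance V} {α d : ℝ}

open Classical in
/-- The set `Q = M ∪ V_1 ∪ VC'` queried in the first stage. -/
def firstStage (T : ThresholdRun I α d) : Finset V :=
  (I.likelyMandatory d).toFinset ∪ (Subtype.val '' {v | T.x v = 1}).toFinset ∪
    T.cover.image Subtype.val

open Classical in
/-- The set of all vertices queried by the algorithm when the weights are `w`: the set `Q`, and
then the mandatory vertices outside `Q`. -/
def queried (T : ThresholdRun I α d) (w : V → ℝ) : Finset V :=
  T.firstStage ∪ Finset.univ.filter fun v => v ∉ T.firstStage ∧ I.Mandatory w v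

end ThresholdRun

/-- The competitive ratio of Threshold with parameter `d` and an `α`-approximation for vertex
cover: the supremum of `E[ALG] / E[OPT]` over all instances and all executions, where
`a / 0 = ∞` for `a > 0`, and `0 / 0 = 0`. -/
def thresholdCompetitiveRatio (α d : ℝ) : ℝ≥0∞ :=
  ⨆ (V : Type u) (_ : Fintype V) (I : OrientationInstance V) (T : ThresholdRun I α d),
    ENNReal.ofReal (∫ w, I.totalCost (T.queried w) ∂I.law) /
      ENNReal.ofReal (∫ w, I.opt w ∂I.law)

end

/-! A query set is feasible exactly when it is a vertex cover containing every vertex whose interval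
contains a neighbour's weight (`feasible_iff`); these forced vertices are the mandatory ones
(`mandatory_iff`). Hence OPT is almost surely the cost of a cheapest vertex cover containing the
forced set. Let `f v` be the probability that this cover contains `v`. Then `E[OPT] = ∑ c_v f_v`,
`p_v ≤ f_v`, and `f` is a fractional vertex cover.

Threshold pays `c_v` for `v ∈ M`, where `f_v ≥ p_v ≥ d`, so the factor there is `1/d`. Outside `M`,
where `p_v < d`, the half-integral LP optimum splits the vertices. On the integral part, comparing
`x` with `f`, and with `f` lowered by `p` on the zeros of `x`, bounds `c(V_1)` plus the expected
cost of mandatory zeros by `(1 + d)` times the share of OPT (`mul_sum_one_le`). On `V_{1/2}`, the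
expected cost is at most `d c(V_{1/2}) + (1 - d) c(VC')`; LP optimality (`sum_half_le`) and the
approximation guarantee (`sum_halfCover_le`) bound this by `2d + (1 - d)α = α + (2 - α)d` times the
share of OPT. As `α ≥ 1`, this factor also dominates `1 + d`. -/

noncomputable section

/-! ### The linear programming relaxation of vertex cover -/

section VertexCoverRelaxation

variable {W : Type*} {H : SimpleGraph W}

/-- The two entries of a tight edge are mirror images about 1/2 in `[0, 1]`. Moving the entries
strictly between 0 and 1/2 one way and those strictly between 1/2 and 1 the other way therefore
keeps tight edges tight. Entries above 1 lie on no tight edge and may move freely. Both signs of a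
small move stay feasible, so an extreme point admits no nonzero move. -/
theorem half_integral_of_mem_extremePoints [Finite W] {x : W → ℝ}
    (hx : x ∈ (vertexCoverPolyhedron H).extremePoints ℝ) (v : W) :
    x v = 0 ∨ x v = 1 / 2 ∨ x v = 1 := by
  classical
  obtain ⟨⟨hedge, hnn⟩, hext⟩ := hx
  by_contra! hv
  -- the direction of a perturbation that keeps every tight constraint tight
  let s : W → ℝ := fun u => if x u = 0 ∨ x u = 1 / 2 ∨ x u = 1 then 0 else
    if x u < 1 / 2 then 1 else if x u < 1 then -1 else 1
  have hst : ∀ u w, x u + x w = 1 → s u + s w = 0 := by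
    intro u w h
    have hu := hnn u
    have hw := hnn w
    simp only [s]
    clear * - h hu hw
    grind
  have hs : ∀ u, |s u| ≤ 1 := by
    intro u
    simp only [s]
    split_ifs <;> norm_num
  have hs0 : ∀ u, x u = 0 → s u = 0 := fun u hu => by simp [s, hu]
  -- The factor 2 is there because both endpoints of a slack edge may drop by `ε`.
  obtain ⟨ε, hε, hε1, hε2⟩ : ∃ ε : ℝ, 0 < ε ∧ (∀ u, 0 < x u → ε ≤ x u) ∧
      ∀ u w, 1 < x u + x w → 2 * ε ≤ x u + x w - 1 := by
    have h1 : ∀ᶠ ε : ℝ in nhdsWithin 0 (Ioi 0), ∀ u, 0 < x u → ε ≤ x u := by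
      refine Filter.eventually_all.2 fun u => ?_
      by_cases hu : 0 < x u
      · filter_upwards [Ioo_mem_nhdsGT hu] with ε hε _ using hε.2.le
      · exact Filter.Eventually.of_forall fun _ h => absurd h hu
    have h2 : ∀ᶠ ε : ℝ in nhdsWithin 0 (Ioi 0), ∀ u w, 1 < x u + x w →
        2 * ε ≤ x u + x w - 1 := by
      refine Filter.eventually_all.2 fun u => Filter.eventually_all.2 fun w => ?_
      by_cases hu : 1 < x u + x w
      · have : 0 < (x u + x w - 1) / 2 := by linarith
        filter_upwards [Ioo_mem_nhdsGT this] with ε hε _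
        linarith [hε.2]
      · exact Filter.Eventually.of_forall fun _ h => absurd h hu
    obtain ⟨ε, ⟨h1, h2⟩, h0⟩ := ((h1.and h2).and self_mem_nhdsWithin).exists
    exact ⟨ε, h0, h1, h2⟩
  have hmem : ∀ σ : ℝ, |σ| ≤ 1 → (fun u => x u + σ * ε * s u) ∈ vertexCoverPolyhedron H := by
    intro σ hσ
    have key : ∀ u, |σ * ε * s u| ≤ ε := fun u => by
      rw [abs_mul, abs_mul, abs_of_pos hε]
      calc |σ| * ε * |s u| ≤ 1 * ε * 1 := by
            gcongr
            exact hs u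
        _ = ε := by ring
    refine ⟨fun u w huw => ?_, fun u => ?_⟩
    · rcases (hedge u w huw).eq_or_lt with h | h
      · have h' : σ * ε * s u + σ * ε * s w = σ * ε * (s u + s w) := by ring
        rw [hst u w h.symm, mul_zero] at h'
        simp only
        linarith
      · have := hε2 u w h
        have h1 := (abs_le.1 (key u)).1
        have h2 := (abs_le.1 (key w)).1
        simp only
        linarith
    · rcases (hnn u).eq_or_lt with h | h
      · simp [hs0 u h.symm, ← h]
      · have := hε1 u h
        have h1 := (abs_le.1 (key u)).1
        simp only
        linarith
  have hopen : x ∈ openSegment ℝ (fun u => x u + 1 * ε * s u) (fun u => x u + -1 * ε * s u) := by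
    refine ⟨1 / 2, 1 / 2, by norm_num, by norm_num, by norm_num, ?_⟩
    ext u
    simp only [Pi.add_apply, Pi.smul_apply, smul_eq_mul]
    ring
  have heq := congrFun (hext (hmem 1 (by simp)) (hmem (-1) (by simp)) hopen) v
  have hsv : s v = 0 := by
    simpa [hε.ne'] using heq
  simp only [s] at hsv
  grind

/-- A basic optimum exists: an extreme point of the compact face on which first the weight and then
the sum of the entries is minimal. -/
theorem exists_isOptimalBasicSolution [Fintype W] (H : SimpleGraph W) {c : W → ℝ}
    (hc : ∀ v, 0 ≤ c v) : ∃ x, IsOptimalBasicSolution H c x := by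
  classical
  set P := vertexCoverPolyhedron H with hP
  have hPc : IsClosed P := by
    have : P = (⋂ u, ⋂ v, ⋂ _ : H.Adj u v, {x : W → ℝ | 1 ≤ x u + x v}) ∩
        ⋂ v, {x : W → ℝ | 0 ≤ x v} := by
      ext x
      simp [hP, vertexCoverPolyhedron]
    rw [this]
    refine IsClosed.inter (isClosed_iInter fun u => isClosed_iInter fun v => isClosed_iInter
      fun _ => isClosed_le (by fun_prop) (by fun_prop)) (isClosed_iInter fun v =>
      isClosed_le (by fun_prop) (by fun_prop))
  have hcomp : ∀ N : ℝ, IsCompact (P ∩ Icc 0 fun _ => N) := fun N =>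
    isCompact_Icc.inter_left hPc
  obtain ⟨x₀, hx₀, hmin₀⟩ : ∃ x₀ ∈ P, ∀ y ∈ P, ∑ v, c v * x₀ v ≤ ∑ v, c v * y v := by
    obtain ⟨x₀, hx₀, hmin⟩ := (hcomp 1).exists_isMinOn
      ⟨fun _ => 1, ⟨fun _ _ _ => by norm_num, fun _ => by norm_num⟩, fun _ => by simp,
        fun _ => le_rfl⟩ (f := fun x => ∑ v, c v * x v) (by fun_prop)
    refine ⟨x₀, hx₀.1, fun y hy => ?_⟩
    -- Truncation at 1 preserves feasibility and raises no cost, so the minimum over the cube is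
    -- global.
    have hy' : (fun v => min (y v) 1) ∈ P ∩ Icc 0 fun _ => 1 := by
      refine ⟨⟨fun u v huv => ?_, fun v => le_min (hy.2 v) zero_le_one⟩,
        fun v => le_min (hy.2 v) zero_le_one, fun v => min_le_right _ _⟩
      have := hy.1 u v huv
      have h1 := hy.2 u
      have h2 := hy.2 v
      simp only
      rcases min_cases (y u) 1 with h | h <;> rcases min_cases (y v) 1 with h' | h' <;> linarith
    exact (hmin hy').trans (Finset.sum_le_sum fun v _ =>
      mul_le_mul_of_nonneg_left (min_le_left _ _) (hc v))
  -- the optimal face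
  set F := {x ∈ P | ∀ y ∈ P, ∑ v, c v * x v ≤ ∑ v, c v * y v} with hF
  have hlin : ∀ (a : W → ℝ), ∃ l : (W → ℝ) →L[ℝ] ℝ, ∀ x, l x = -∑ v, a v * x v := fun a =>
    ⟨-∑ v, a v • ContinuousLinearMap.proj v, fun x => by simp⟩
  have hFP : IsExposed ℝ P F := by
    intro _
    obtain ⟨l, hl⟩ := hlin c
    refine ⟨l, ?_⟩
    simp [hF, hl]
  have hFc : IsClosed F := hFP.isClosed hPc
  -- Vertices of cost zero can make `F` unbounded; minimizing the sum of the entries cuts out a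
  -- compact face.
  obtain ⟨x₁, hx₁, hmin₁⟩ : ∃ x₁ ∈ F, ∀ y ∈ F, ∑ v, 1 * x₁ v ≤ ∑ v, 1 * y v := by
    have hK : IsCompact (F ∩ Icc 0 fun _ => ∑ v, x₀ v) := isCompact_Icc.inter_left hFc
    have hle : ∀ y ∈ P, ∀ v, y v ≤ ∑ v, y v := fun y hy v =>
      Finset.single_le_sum (fun u _ => hy.2 u) (Finset.mem_univ v)
    have hx₀K : x₀ ∈ F ∩ Icc 0 fun _ => ∑ v, x₀ v :=
      ⟨⟨hx₀, hmin₀⟩, fun v => hx₀.2 v, hle x₀ hx₀⟩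
    obtain ⟨x₁, hx₁, hmin⟩ := hK.exists_isMinOn ⟨x₀, hx₀K⟩ (f := fun x => ∑ v, 1 * x v)
      (by fun_prop)
    refine ⟨x₁, hx₁.1, fun y hy => ?_⟩
    by_cases h : ∑ v, y v ≤ ∑ v, x₀ v
    · exact hmin ⟨hy, fun v => hy.1.2 v, fun v => (hle y hy.1 v).trans h⟩
    · refine (hmin hx₀K).trans ?_
      simpa using (not_le.1 h).le
  set F' := {x ∈ F | ∀ y ∈ F, ∑ v, 1 * x v ≤ ∑ v, 1 * y v} with hF'
  have hF'F : IsExposed ℝ F F' := by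
    intro _
    obtain ⟨l, hl⟩ := hlin fun _ => 1
    refine ⟨l, ?_⟩
    simp [hF', hl]
  have hF'c : IsCompact F' := by
    refine IsCompact.of_isClosed_subset (isCompact_Icc (a := (0 : W → ℝ))
      (b := fun _ => ∑ v, x₁ v)) (hF'F.isClosed hFc) fun y hy => ⟨fun v => hy.1.1.2 v, fun v => ?_⟩
    have h1 := Finset.single_le_sum (f := y) (fun u _ => hy.1.1.2 u) (Finset.mem_univ v)
    have h2 := hy.2 x₁ hx₁
    simp only [one_mul] at h2
    exact h1.trans h2
  obtain ⟨x, hx⟩ := hF'c.extremePoints_nonempty ⟨x₁, hx₁, hmin₁⟩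
  have hext := (hFP.isExtreme.trans hF'F.isExtreme).extremePoints_subset_extremePoints hx
  exact ⟨x, hext, hx.1.1.2⟩

theorem exists_isApproxVertexCover [Fintype W] (H : SimpleGraph W) {c : W → ℝ}
    (hc : ∀ v, 0 ≤ c v) {α : ℝ} (hα : 1 ≤ α) : ∃ C, IsApproxVertexCover α H c C := by
  classical
  obtain ⟨C, hC, hmin⟩ := Finset.exists_min_image
    (Finset.univ.filter fun C : Finset W => H.IsVertexCover (C : Set W))
    (fun C => ∑ v ∈ C, c v) ⟨Finset.univ, by simp⟩
  refine ⟨C, (Finset.mem_filter.1 hC).2, fun C' hC' => ?_⟩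
  have h1 := hmin C' (by simpa using hC')
  have h2 : 0 ≤ ∑ v ∈ C', c v := Finset.sum_nonneg fun v _ => hc v
  nlinarith

namespace IsOptimalBasicSolution

variable [Fintype W] {c x : W → ℝ}

theorem half_integral (hx : IsOptimalBasicSolution H c x) (v : W) :
    x v = 0 ∨ x v = 1 / 2 ∨ x v = 1 :=
  half_integral_of_mem_extremePoints hx.basic v

open Classical in
/-- On the integral part of an optimal basic solution no fractional cover, scaled by `t`, is
cheaper than the solution. -/
theorem mul_sum_one_le (hx : IsOptimalBasicSolution H c x) {t : ℝ} (ht₁ : t ≤ 1)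
    {z : W → ℝ} (hz : ∀ v, 0 ≤ z v)
    (hedge : ∀ u v, H.Adj u v → x u = 0 → x v = 1 → t ≤ z u + z v) :
    t * ∑ v, (if x v = 1 then c v else 0) ≤ ∑ v, if x v = 1 / 2 then 0 else c v * z v := by
  -- The midpoint of `x` and the point with values `1 - t + z` on `V_1` and `z` on the zeros.
  -- Halving keeps the entries on `V_1` at least 1/2, which edges from `V_1` to `V_{1/2}` need.
  have hmem : (fun v => if x v = 1 / 2 then 1 / 2 else if x v = 1 then 1 - t / 2 + z v / 2
      else z v / 2) ∈ vertexCoverPolyhedron H := by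
    refine ⟨fun u v huv => ?_, fun v => ?_⟩
    · have h := hx.basic.1.1 u v huv
      have e1 := hedge u v huv
      have e2 := hedge v u huv.symm
      have zu := hz u
      have zv := hz v
      rcases hx.half_integral u with hu | hu | hu <;> rcases hx.half_integral v with hv | hv | hv <;>
        simp only [hu, hv] at h e1 e2 ⊢ <;>
        first | (exfalso; linarith only [h]) | (norm_num at e1 e2 ⊢ <;> linarith)
    · have zv := hz v
      simp only
      split_ifs <;> linarith
  have h := sub_nonneg.2 (hx.optimal _ hmem)
  rw [← Finset.sum_sub_distrib] at h
  rw [← sub_nonneg, Finset.mul_sum, ← Finset.sum_sub_distrib]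
  have : ∑ v, ((if x v = 1 / 2 then 0 else c v * z v) - t * (if x v = 1 then c v else 0)) =
      2 * ∑ v, (c v * (if x v = 1 / 2 then 1 / 2 else if x v = 1 then 1 - t / 2 + z v / 2
      else z v / 2) - c v * x v) := by
    rw [Finset.mul_sum]
    refine Finset.sum_congr rfl fun v _ => ?_
    rcases hx.half_integral v with hv | hv | hv <;> simp only [hv] <;> norm_num <;> ring
  rw [this]
  linarith

open Classical in
/-- On the half-integral part of an optimal basic solution no fractional cover is cheaper than the
solution. -/
theorem sum_half_le (hx : IsOptimalBasicSolution H c x) {z : W → ℝ} (hz : ∀ v, 0 ≤ z v)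
    (hedge : ∀ u v, H.Adj u v → x u = 1 / 2 → x v = 1 / 2 → 1 ≤ z u + z v) :
    ∑ v, (if x v = 1 / 2 then c v else 0) ≤ 2 * ∑ v, if x v = 1 / 2 then c v * z v else 0 := by
  -- An edge leaving `V_{1/2}` ends at a vertex of value 1, so it stays covered whatever `z` is.
  have hmem : (fun v => if x v = 1 / 2 then z v else x v) ∈ vertexCoverPolyhedron H := by
    refine ⟨fun u v huv => ?_, fun v => ?_⟩
    · have h := hx.basic.1.1 u v huv
      have e1 := hedge u v huv
      have zu := hz u
      have zv := hz v
      rcases hx.half_integral u with hu | hu | hu <;> rcases hx.half_integral v with hv | hv | hv <;>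
        simp only [hu, hv] at h e1 ⊢ <;>
        first | (exfalso; linarith only [h]) | (norm_num at e1 ⊢ <;>
          linarith only [e1, zu, zv, h])
    · have zv := hz v
      have := hx.basic.1.2 v
      simp only
      split_ifs <;> linarith
  have h := sub_nonneg.2 (hx.optimal _ hmem)
  rw [← Finset.sum_sub_distrib] at h
  rw [← sub_nonneg, Finset.mul_sum, ← Finset.sum_sub_distrib]
  have : ∑ v, (2 * (if x v = 1 / 2 then c v * z v else 0) - (if x v = 1 / 2 then c v else 0)) =
      2 * ∑ v, (c v * (if x v = 1 / 2 then z v else x v) - c v * x v) := by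
    rw [Finset.mul_sum]
    refine Finset.sum_congr rfl fun v _ => ?_
    rcases hx.half_integral v with hv | hv | hv <;> simp only [hv] <;> norm_num <;> ring
  rw [this]
  linarith

end IsOptimalBasicSolution

end VertexCoverRelaxation

/-! ### Feasible query sets and the expected optimum -/

namespace OrientationInstance

variable {V : Type*} [Fintype V] (I : OrientationInstance V)

open Classical in
/-- The vertices whose interval contains the weight of a neighbour. -/
def forced (w : V → ℝ) : Finset V :=
  Finset.univ.filter fun v => ∃ u, I.graph.Adj u v ∧ w u ∈ I.interval v

variable {I} in
theorem mem_forced {w : V → ℝ} {v : V} :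
    v ∈ I.forced w ↔ ∃ u, I.graph.Adj u v ∧ w u ∈ I.interval v := by
  simp [forced]

variable {I} in
theorem IsRealization.update [DecidableEq V] {w : V → ℝ} (hw : I.IsRealization w) {v : V} {y : ℝ}
    (hy : y ∈ I.interval v) : I.IsRealization (Function.update w v y) := by
  intro u
  rcases eq_or_ne u v with rfl | h
  · simpa using hy
  · simpa [h] using hw u

/-- If both endpoints of an edge are unqueried, two points of the open overlap can be assigned in
either order. If only `v` is varied and its interval contains a neighbour's weight, `v` can fall on
either side of that weight. Conversely, a queried weight outside the interval of an unqueried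
neighbour settles the edge. -/
theorem feasible_iff {w : V → ℝ} (hw : I.IsRealization w) {Q : Finset V} :
    I.Feasible w Q ↔ I.graph.IsVertexCover (Q : Set V) ∧ I.forced w ⊆ Q := by
  classical
  have agree : ∀ {v y}, v ∉ Q → ∀ q ∈ Q, Function.update w v y q = w q := fun hv q hq =>
    Function.update_of_ne (ne_of_mem_of_not_mem hq hv) _ _
  constructor
  · intro hQ
    refine ⟨fun u v huv => ?_, fun v hv => ?_⟩
    · by_contra! hn
      simp only [Finset.mem_coe] at hn
      obtain ⟨z, ⟨hz1, hz2⟩, hz3, hz4⟩ := I.overlap u v huv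
      obtain ⟨y, hy1, hy2⟩ := exists_between (lt_min hz2 hz4)
      obtain ⟨hy2, hy3⟩ := lt_min_iff.1 hy2
      have r1 : I.IsRealization (Function.update (Function.update w u z) v y) :=
        (hw.update ⟨hz1, hz2⟩).update ⟨hz3.trans hy1, hy3⟩
      have r2 : I.IsRealization (Function.update (Function.update w u y) v z) :=
        (hw.update ⟨hz1.trans hy1, hy2⟩).update ⟨hz3, hz4⟩
      have ag : ∀ a b, ∀ q ∈ Q, Function.update (Function.update w u a) v b q = w q := by
        intro a b q hq
        rw [Function.update_of_ne (ne_of_mem_of_not_mem hq hn.2),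
          Function.update_of_ne (ne_of_mem_of_not_mem hq hn.1)]
      rcases hQ u v huv with h | h
      · have := h _ r2 (ag _ _)
        simp [huv.ne] at this
        linarith
      · have := h _ r1 (ag _ _)
        simp [huv.ne] at this
        linarith
    · obtain ⟨u, huv, h1, h2⟩ := mem_forced.1 hv
      by_contra hvQ
      have hlr := (hw v).1.trans (hw v).2
      rcases hQ u v huv with h | h
      · obtain ⟨y, hy1, hy2⟩ := exists_between h1
        have := h _ (hw.update (v := v) ⟨hy1, hy2.trans h2⟩) (agree hvQ)
        simp [huv.ne] at this
        linarith
      · obtain ⟨y, hy1, hy2⟩ := exists_between h2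
        have := h _ (hw.update (v := v) ⟨h1.trans hy1, hy2⟩) (agree hvQ)
        simp [huv.ne] at this
        linarith
  · rintro ⟨hcov, hforced⟩
    have key : ∀ u v, I.graph.Adj u v → u ∈ Q →
        (∀ w', I.IsRealization w' → (∀ q ∈ Q, w' q = w q) → w' u ≤ w' v) ∨
        (∀ w', I.IsRealization w' → (∀ q ∈ Q, w' q = w q) → w' v ≤ w' u) := by
      intro u v huv hu
      by_cases hv : v ∈ Q
      · rcases le_total (w u) (w v) with h | h
        · exact Or.inl fun w' _ h' => by rwa [h' u hu, h' v hv]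
        · exact Or.inr fun w' _ h' => by rwa [h' u hu, h' v hv]
      · have hn : w u ∉ I.interval v := fun h => hv (hforced (mem_forced.2 ⟨u, huv, h⟩))
        rcases le_or_gt (w u) (I.left v) with h | h
        · exact Or.inl fun w' hw' h' => by
            rw [h' u hu]
            exact h.trans (hw' v).1.le
        · have h2 : I.right v ≤ w u := not_lt.1 fun h2 => hn ⟨h, h2⟩
          exact Or.inr fun w' hw' h' => by
            rw [h' u hu]
            exact (hw' v).2.le.trans h2
    intro u v huv
    rcases hcov huv with hu | hv
    · exact key u v huv hu
    · exact (key v u huv.symm hv).symm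

theorem mandatory_iff {w : V → ℝ} (hw : I.IsRealization w) {v : V} :
    I.Mandatory w v ↔ v ∈ I.forced w := by
  classical
  refine ⟨fun h => ?_, fun h Q hQ => ((I.feasible_iff hw).1 hQ).2 h⟩
  by_contra hv
  -- All vertices but one always form a vertex cover, so only being forced can make `v` mandatory.
  have : I.Feasible w (Finset.univ.erase v) := by
    refine (I.feasible_iff hw).2 ⟨fun a b hab => ?_, fun u hu => ?_⟩
    · by_cases ha : a = v
      · exact Or.inr (by simpa using fun hb => hab.ne (ha.trans hb.symm))
      · exact Or.inl (by simpa using ha)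
    · have : u ≠ v := fun huv => hv (huv ▸ hu)
      simpa using this
  simpa using h _ this

open Classical in
theorem totalCost_eq_sum_ite (S : Finset V) :
    I.totalCost S = ∑ v, I.cost v * if v ∈ S then 1 else 0 := by
  simp [totalCost]

theorem exists_cheapest_cover (S : Finset V) :
    ∃ F : Finset V, (I.graph.IsVertexCover (F : Set V) ∧ S ⊆ F) ∧
      ∀ F' : Finset V, I.graph.IsVertexCover (F' : Set V) → S ⊆ F' →
        I.totalCost F ≤ I.totalCost F' := by
  classical
  obtain ⟨F, hF, hmin⟩ := Finset.exists_min_image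
    (Finset.univ.filter fun F : Finset V => I.graph.IsVertexCover (F : Set V) ∧ S ⊆ F)
    I.totalCost ⟨Finset.univ, by simp⟩
  exact ⟨F, (Finset.mem_filter.1 hF).2, fun F' h1 h2 => hmin F' (by simp [h1, h2])⟩

/-- A cheapest vertex cover that contains `S`. -/
def cheapestCover (S : Finset V) : Finset V := (I.exists_cheapest_cover S).choose

theorem isVertexCover_cheapestCover (S : Finset V) :
    I.graph.IsVertexCover (I.cheapestCover S : Set V) :=
  (I.exists_cheapest_cover S).choose_spec.1.1

theorem subset_cheapestCover (S : Finset V) : S ⊆ I.cheapestCover S :=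
  (I.exists_cheapest_cover S).choose_spec.1.2

theorem opt_eq {w : V → ℝ} (hw : I.IsRealization w) :
    I.opt w = I.totalCost (I.cheapestCover (I.forced w)) := by
  refine IsLeast.csInf_eq ⟨⟨_, (I.feasible_iff hw).2
    ⟨I.isVertexCover_cheapestCover _, I.subset_cheapestCover _⟩, rfl⟩, ?_⟩
  rintro _ ⟨Q, hQ, rfl⟩
  obtain ⟨h1, h2⟩ := (I.feasible_iff hw).1 hQ
  exact (I.exists_cheapest_cover _).choose_spec.2 Q h1 h2

instance : IsProbabilityMeasure I.law := by
  unfold law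
  infer_instance

theorem ae_isRealization : ∀ᵐ w ∂I.law, I.IsRealization w := by
  refine ae_all_iff.2 fun v => ?_
  have h : ∀ᵐ t ∂I.dist v, t ∈ I.interval v := by
    have h1 : ∀ᵐ t ∂I.dist v, t ∉ Iic (I.left v) :=
      measure_eq_zero_iff_ae_notMem.1 (I.left_isGreatest v).1
    have h2 : ∀ᵐ t ∂I.dist v, t ∉ Ici (I.right v) :=
      measure_eq_zero_iff_ae_notMem.1 (I.right_isLeast v).1
    filter_upwards [h1, h2] with t ht1 ht2
    exact ⟨not_le.1 ht1, not_le.1 ht2⟩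
  exact (Measure.quasiMeasurePreserving_eval (μ := I.dist) v).ae h

/-- All random quantities are almost surely functions of the forced set, which takes finitely many
values; this gives their integrability. -/
theorem measurable_comp_forced (g : Finset V → ℝ) : Measurable fun w => g (I.forced w) := by
  let _ : MeasurableSpace (Finset V) := ⊤
  have h : Measurable I.forced := by
    refine measurable_to_countable' fun S => ?_
    have : I.forced ⁻¹' {S} = ⋂ v, {w | v ∈ I.forced w ↔ v ∈ S} := by
      ext w
      simp [Finset.ext_iff]
    rw [this]
    refine MeasurableSet.iInter fun v => ?_
    refine MeasurableSet.iff ?_ (MeasurableSet.const _)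
    have : {w | v ∈ I.forced w} = ⋃ u, ⋃ _ : I.graph.Adj u v, {w | w u ∈ I.interval v} := by
      ext w
      simp [mem_forced]
    rw [this]
    exact MeasurableSet.iUnion fun u => MeasurableSet.iUnion fun _ =>
      measurable_pi_apply u measurableSet_Ioo
  exact (measurable_of_finite g).comp h

theorem integrable_comp_forced (g : Finset V → ℝ) :
    Integrable (fun w => g (I.forced w)) I.law := by
  obtain ⟨C, hC⟩ := (Set.finite_range fun S => ‖g S‖).bddAbove
  exact Integrable.of_bound (I.measurable_comp_forced g).aestronglyMeasurable C
    (Filter.Eventually.of_forall fun w => hC ⟨_, rfl⟩)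

theorem integrable_opt : Integrable I.opt I.law := by
  refine (I.integrable_comp_forced fun S => I.totalCost (I.cheapestCover S)).congr ?_
  filter_upwards [I.ae_isRealization] with w hw using (I.opt_eq hw).symm

open Classical in
/-- The probability that the optimal query set contains `v`. -/
def optProb (v : V) : ℝ := ∫ w, (if v ∈ I.cheapestCover (I.forced w) then 1 else 0) ∂I.law

open Classical in
theorem integral_sum_cheapestCover (a : V → ℝ) :
    ∫ w, ∑ v, a v * (if v ∈ I.cheapestCover (I.forced w) then 1 else 0) ∂I.law =
      ∑ v, a v * I.optProb v := by
  rw [integral_finsetSum]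
  · exact Finset.sum_congr rfl fun v _ => by rw [integral_const_mul, optProb]
  · exact fun v _ => I.integrable_comp_forced
      fun S => a v * if v ∈ I.cheapestCover S then 1 else 0

theorem integral_opt : ∫ w, I.opt w ∂I.law = ∑ v, I.cost v * I.optProb v := by
  classical
  rw [← integral_sum_cheapestCover]
  refine integral_congr_ae ?_
  filter_upwards [I.ae_isRealization] with w hw
  rw [I.opt_eq hw, totalCost_eq_sum_ite]

open Classical in
-- Transfers a linear inequality valid for every optimal cover to the vector of inclusion
-- probabilities.
theorem le_sum_mul_optProb {a : V → ℝ} {D : ℝ}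
    (h : ∀ S, D ≤ ∑ v, a v * if v ∈ I.cheapestCover S then 1 else 0) :
    D ≤ ∑ v, a v * I.optProb v := by
  rw [← integral_sum_cheapestCover]
  calc D = ∫ _, D ∂I.law := by simp
    _ ≤ _ := integral_mono (integrable_const _) (I.integrable_comp_forced
      fun S => ∑ v, a v * if v ∈ I.cheapestCover S then 1 else 0) fun w => h _

open Classical in
theorem mandatoryProb_eq (v : V) :
    I.mandatoryProb v = ∫ w, (if v ∈ I.forced w then 1 else 0) ∂I.law := by
  have hm : MeasurableSet {w | v ∈ I.forced w} := by
    have := I.measurable_comp_forced (fun S => if v ∈ S then 1 else 0) (measurableSet_singleton 1)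
    convert this using 1
    ext w
    simp
  have h : {w | I.Mandatory w v} =ᵐ[I.law] {w | v ∈ I.forced w} := by
    filter_upwards [I.ae_isRealization] with w hw
    exact propext (I.mandatory_iff hw)
  rw [mandatoryProb, measureReal_congr h, ← integral_indicator_one hm]
  refine integral_congr_ae (Filter.Eventually.of_forall fun w => ?_)
  simp [Set.indicator]

theorem mandatoryProb_nonneg (v : V) : 0 ≤ I.mandatoryProb v := measureReal_nonneg

theorem mandatoryProb_le_optProb (v : V) : I.mandatoryProb v ≤ I.optProb v := by
  classical
  rw [mandatoryProb_eq, optProb]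
  refine integral_mono (I.integrable_comp_forced fun S => if v ∈ S then 1 else 0)
    (I.integrable_comp_forced fun S => if v ∈ I.cheapestCover S then 1 else 0) fun w => ?_
  have h : v ∈ I.forced w → v ∈ I.cheapestCover (I.forced w) :=
    fun h => I.subset_cheapestCover _ h
  simp only
  split_ifs with h1 h2 <;> first | exact absurd (h h1) h2 | norm_num

theorem one_le_optProb_add {u v : V} (huv : I.graph.Adj u v) :
    1 ≤ I.optProb u + I.optProb v := by
  classical
  have h := I.le_sum_mul_optProb (D := 1)
    (a := fun x => (if x = u then 1 else 0) + if x = v then 1 else 0) fun S => by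
      rcases I.isVertexCover_cheapestCover S huv with h | h <;>
      · simp only [add_mul, Finset.sum_add_distrib, ite_mul, one_mul, zero_mul,
          Finset.sum_ite_eq', Finset.mem_univ, if_true, if_pos (Finset.mem_coe.1 h)]
        split_ifs <;> norm_num
  simpa [add_mul, Finset.sum_add_distrib] using h

end OrientationInstance

open Classical in
theorem sum_subtype_compl_add_sum_ite {V : Type*} [Fintype V] (M : Set V) [Fintype (Mᶜ : Set V)]
    (g : V → ℝ) : ∑ v : (Mᶜ : Set V), g v + ∑ v, (if v ∈ M then g v else 0) = ∑ v, g v := by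
  have : ∑ v : (Mᶜ : Set V), g v = ∑ v, if v ∈ M then 0 else g v := by
    rw [← Finset.sum_subtype (Finset.univ.filter (· ∉ M)) (by simp) g, Finset.sum_filter]
    simp
  rw [this, ← Finset.sum_add_distrib]
  refine Finset.sum_congr rfl fun v _ => ?_
  split_ifs <;> simp

/-! ### Correctness and expected cost of Threshold -/

namespace ThresholdRun

variable {V : Type*} [Fintype V] {I : OrientationInstance V} {α d : ℝ}

theorem nonempty (I : OrientationInstance V) (hα : 1 ≤ α) (d : ℝ) :
    Nonempty (ThresholdRun I α d) := by
  classical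
  obtain ⟨x, hx⟩ := exists_isOptimalBasicSolution (I.graph.induce (I.likelyMandatory d)ᶜ)
    (c := fun v => I.cost v) fun v => I.cost_nonneg v
  obtain ⟨C, hC⟩ := exists_isApproxVertexCover
    (I.graph.induce (Subtype.val '' {v | x v = 1 / 2})) (c := fun v => I.cost v)
    (fun v => I.cost_nonneg v) hα
  exact ⟨⟨x, by convert hx, C, by convert hC⟩⟩

variable (T : ThresholdRun I α d)

open Classical in
/-- The vertex cover `VC'` of `G[V_{1/2}]` as a set of vertices of `G`. -/
def halfCover : Finset V := T.cover.image Subtype.val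

theorem mem_firstStage {v : V} : v ∈ T.firstStage ↔ v ∈ I.likelyMandatory d ∨
    (∃ h : v ∈ (I.likelyMandatory d)ᶜ, T.x ⟨v, h⟩ = 1) ∨ v ∈ T.halfCover := by
  simp [firstStage, halfCover]

theorem mem_half {v : V} : v ∈ (Subtype.val '' {v | T.x v = 1 / 2} : Set V) ↔
    ∃ h : v ∈ (I.likelyMandatory d)ᶜ, T.x ⟨v, h⟩ = 1 / 2 := by
  simp

theorem half_of_mem_halfCover {v : V} (hv : v ∈ T.halfCover) :
    ∃ h : v ∈ (I.likelyMandatory d)ᶜ, T.x ⟨v, h⟩ = 1 / 2 := by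
  classical
  obtain ⟨u, _, rfl⟩ := Finset.mem_image.1 hv
  exact T.mem_half.1 u.2

theorem isVertexCover_firstStage : I.graph.IsVertexCover (T.firstStage : Set V) := by
  classical
  intro u v huv
  simp only [Finset.mem_coe]
  by_contra! hn
  obtain ⟨hu, hv⟩ := hn
  rw [mem_firstStage] at hu hv
  push Not at hu hv
  obtain ⟨huM, hu1, huC⟩ := hu
  obtain ⟨hvM, hv1, hvC⟩ := hv
  have h := T.x_spec.basic.1.1 ⟨u, huM⟩ ⟨v, hvM⟩ huv
  have hu1 := hu1 huM
  have hv1 := hv1 hvM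
  have hhalf : T.x ⟨u, huM⟩ = 1 / 2 ∧ T.x ⟨v, hvM⟩ = 1 / 2 := by
    rcases T.x_spec.half_integral ⟨u, huM⟩ with h1 | h1 | h1 <;>
    rcases T.x_spec.half_integral ⟨v, hvM⟩ with h2 | h2 | h2 <;>
    first
    | exact ⟨h1, h2⟩
    | exact absurd h1 hu1
    | exact absurd h2 hv1
    | (exfalso; linarith)
  rcases T.cover_spec.isVertexCover
    (show (I.graph.induce (Subtype.val '' {v | T.x v = 1 / 2})).Adj
      ⟨u, T.mem_half.2 ⟨huM, hhalf.1⟩⟩ ⟨v, T.mem_half.2 ⟨hvM, hhalf.2⟩⟩ from huv) with h | h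
  · exact huC (Finset.mem_image.2 ⟨_, h, rfl⟩)
  · exact hvC (Finset.mem_image.2 ⟨_, h, rfl⟩)

theorem mem_queried_iff {w : V → ℝ} (hw : I.IsRealization w) {v : V} :
    v ∈ T.queried w ↔ v ∈ T.firstStage ∨ v ∈ I.forced w := by
  simp only [queried, Finset.mem_union, Finset.mem_filter, Finset.mem_univ, true_and,
    I.mandatory_iff hw]
  tauto

theorem feasible_queried {w : V → ℝ} (hw : I.IsRealization w) : I.Feasible w (T.queried w) := by
  refine (I.feasible_iff hw).2 ⟨fun u v huv => ?_, fun v hv => (T.mem_queried_iff hw).2 (.inr hv)⟩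
  exact (T.isVertexCover_firstStage huv).imp (fun h => (T.mem_queried_iff hw).2 (.inl h))
    (fun h => (T.mem_queried_iff hw).2 (.inl h))

/-- The first stage is a vertex cover, so every neighbour of a vertex outside it has been queried,
and these weights decide whether the vertex is forced. -/
theorem queried_congr {w w' : V → ℝ} (hw : I.IsRealization w) (hw' : I.IsRealization w')
    (h : ∀ q ∈ T.firstStage, w q = w' q) : T.queried w = T.queried w' := by
  ext v
  rw [T.mem_queried_iff hw, T.mem_queried_iff hw']
  refine or_congr_right' fun hv => ?_
  rw [OrientationInstance.mem_forced, OrientationInstance.mem_forced]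
  refine exists_congr fun u => and_congr_right fun huv => ?_
  rw [h u ((T.isVertexCover_firstStage huv).resolve_right hv)]

open Classical in
theorem totalCost_queried {w : V → ℝ} (hw : I.IsRealization w) : I.totalCost (T.queried w) =
    ∑ v, I.cost v * if v ∈ T.firstStage then 1 else if v ∈ I.forced w then 1 else 0 := by
  rw [I.totalCost_eq_sum_ite]
  refine Finset.sum_congr rfl fun v _ => ?_
  simp only [T.mem_queried_iff hw]
  split_ifs <;> simp_all

theorem integrable_totalCost_queried : Integrable (fun w => I.totalCost (T.queried w)) I.law := by
  classical
  refine (I.integrable_comp_forced fun S => ∑ v, I.cost v *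
    if v ∈ T.firstStage then 1 else if v ∈ S then 1 else 0).congr ?_
  filter_upwards [I.ae_isRealization] with w hw using (T.totalCost_queried hw).symm

open Classical in
theorem integral_totalCost_queried : ∫ w, I.totalCost (T.queried w) ∂I.law =
    ∑ v, I.cost v * if v ∈ T.firstStage then 1 else I.mandatoryProb v := by
  have : (fun w => I.totalCost (T.queried w)) =ᵐ[I.law] fun w =>
      ∑ v, I.cost v * if v ∈ T.firstStage then 1 else if v ∈ I.forced w then 1 else 0 := by
    filter_upwards [I.ae_isRealization] with w hw using T.totalCost_queried hw
  rw [integral_congr_ae this, integral_finsetSum]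
  · refine Finset.sum_congr rfl fun v _ => ?_
    rw [integral_const_mul, I.mandatoryProb_eq]
    split_ifs <;> simp
  · exact fun v _ => I.integrable_comp_forced
      fun S => I.cost v * if v ∈ T.firstStage then 1 else if v ∈ S then 1 else 0

open Classical in
/-- The approximation guarantee of `VC'` against the optimal query sets, on average. -/
theorem sum_halfCover_le : ∑ v : ((I.likelyMandatory d)ᶜ : Set V),
      (if (v : V) ∈ T.halfCover then I.cost v else 0) ≤
    α * ∑ v : ((I.likelyMandatory d)ᶜ : Set V),
      if T.x v = 1 / 2 then I.cost v * I.optProb v else 0 := by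
  have hleft := sum_subtype_compl_add_sum_ite (I.likelyMandatory d)
    fun v => if v ∈ T.halfCover then I.cost v else 0
  have h0 : ∑ v, (if v ∈ I.likelyMandatory d then if v ∈ T.halfCover then I.cost v else 0 else 0)
      = 0 := Finset.sum_eq_zero fun v _ => by
    split_ifs with h1 h2
    · exact absurd h1 (T.half_of_mem_halfCover h2).1
    all_goals rfl
  have hcover : ∑ v, (if v ∈ T.halfCover then I.cost v else 0) = ∑ v ∈ T.cover, I.cost v := by
    rw [Finset.sum_ite_mem, Finset.univ_inter, halfCover,
      Finset.sum_image Subtype.val_injective.injOn]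
  set U : Set V := Subtype.val '' {v | T.x v = 1 / 2} with hU
  have hright := sum_subtype_compl_add_sum_ite (I.likelyMandatory d)
    fun v => (if v ∈ U then I.cost v else 0) * I.optProb v
  have h1 : ∑ v, (if v ∈ I.likelyMandatory d then
      (if v ∈ U then I.cost v else 0) * I.optProb v else 0) = 0 :=
    Finset.sum_eq_zero fun v _ => by
      split_ifs with h1 h2
      · exact absurd h1 (T.mem_half.1 h2).1
      all_goals simp
  have h2 : ∑ v : ((I.likelyMandatory d)ᶜ : Set V),
      (if (v : V) ∈ U then I.cost v else 0) * I.optProb v =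
      ∑ v : ((I.likelyMandatory d)ᶜ : Set V),
      if T.x v = 1 / 2 then I.cost v * I.optProb v else 0 := by
    refine Finset.sum_congr rfl fun v _ => ?_
    have : (v : V) ∈ U ↔ T.x v = 1 / 2 := by
      rw [hU, T.mem_half]
      exact ⟨fun h => h.2, fun h => ⟨v.2, h⟩⟩
    simp only [this]
    split_ifs <;> simp
  have hmain : ∑ v ∈ T.cover, I.cost v ≤
      ∑ v, (α * if v ∈ U then I.cost v else 0) * I.optProb v := by
    refine I.le_sum_mul_optProb fun S => ?_
    -- An optimal cover restricted to `V_{1/2}` covers `G[V_{1/2}]`, hence competes with `VC'`.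
    have := T.cover_spec.approx (Finset.univ.filter fun v => (v : V) ∈ I.cheapestCover S)
      fun u v huv => by simpa using I.isVertexCover_cheapestCover S huv
    refine this.trans_eq ?_
    rw [Finset.sum_filter]
    have e : ∑ v : U, (if (v : V) ∈ I.cheapestCover S then I.cost v else 0) =
        ∑ v, if v ∈ U then (if v ∈ I.cheapestCover S then I.cost v else 0) else 0 := by
      rw [← Finset.sum_subtype (Finset.univ.filter (· ∈ U)) (fun v => Finset.mem_filter_univ v)
        (fun v => if v ∈ I.cheapestCover S then I.cost v else 0), Finset.sum_filter]
    refine (congrArg (α * ·) e).trans ?_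
    rw [Finset.mul_sum]
    refine Finset.sum_congr rfl fun v _ => ?_
    split_ifs <;> simp
  simp only [mul_assoc] at hmain
  rw [← Finset.mul_sum] at hmain
  rw [h0, add_zero] at hleft
  rw [h1, add_zero] at hright
  rwa [← h2, hright, hleft, hcover]

open Classical in
theorem sum_compl_likelyMandatory_le (hα₁ : 1 ≤ α) (hd₀ : 0 < d) (hd₁ : d ≤ 1) :
    ∑ v : ((I.likelyMandatory d)ᶜ : Set V),
        I.cost v * (if (v : V) ∈ T.firstStage then 1 else I.mandatoryProb v) ≤
      (α + (2 - α) * d) * ∑ v : ((I.likelyMandatory d)ᶜ : Set V), I.cost v * I.optProb v := by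
  have hp : ∀ v : ((I.likelyMandatory d)ᶜ : Set V), I.mandatoryProb v ≤ d := fun v =>
    (not_le.1 (show ¬d ≤ I.mandatoryProb v from v.2)).le
  have hp0 := I.mandatoryProb_nonneg
  have hpf := I.mandatoryProb_le_optProb
  have hf0 : ∀ v, 0 ≤ I.optProb v := fun v => (hp0 v).trans (hpf v)
  have hedge : ∀ u v : ((I.likelyMandatory d)ᶜ : Set V),
      (I.graph.induce (I.likelyMandatory d)ᶜ).Adj u v → 1 ≤ I.optProb u + I.optProb v :=
    fun u v huv => I.one_le_optProb_add huv
  have b1 := T.x_spec.mul_sum_one_le (t := 1) le_rfl (z := fun v => I.optProb v)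
    (fun v => hf0 v) fun u v huv _ _ => hedge u v huv
  -- Subtracting `p` only on the zeros of `x` costs an edge between a zero and a one at most `d`.
  have b2 := T.x_spec.mul_sum_one_le (t := 1 - d) (by linarith)
    (z := fun v => I.optProb v - if T.x v = 0 then I.mandatoryProb v else 0)
    (fun v => by split_ifs <;> linarith [hpf v, hf0 v]) fun u v huv hu hv => by
      have h1 := hedge u v huv
      have h2 := hp u
      simp only [hu, hv]
      norm_num
      linarith
  have b3 := T.x_spec.sum_half_le (z := fun v => I.optProb v) (fun v => hf0 v)
    fun u v huv _ _ => hedge u v huv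
  have b4 := T.sum_halfCover_le
  set A := ∑ v, (if T.x v = 1 then I.cost v else 0)
  set Φ := ∑ v, if T.x v = 1 / 2 then 0 else I.cost v * I.optProb v
  set B := ∑ v, (if T.x v = 1 / 2 then I.cost v else 0)
  set Ψ := ∑ v, if T.x v = 1 / 2 then I.cost v * I.optProb v else 0
  set D := ∑ v : ((I.likelyMandatory d)ᶜ : Set V),
      (if (v : V) ∈ T.halfCover then I.cost v else 0)
  have e1 : ∑ v : ((I.likelyMandatory d)ᶜ : Set V), I.cost v * I.optProb v = Φ + Ψ := by
    rw [← Finset.sum_add_distrib]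
    refine Finset.sum_congr rfl fun v _ => ?_
    split_ifs <;> simp
  have e2 : ∑ v : ((I.likelyMandatory d)ᶜ : Set V), (if T.x v = 1 / 2 then 0 else
      I.cost v * (I.optProb v - if T.x v = 0 then I.mandatoryProb v else 0)) =
      Φ - ∑ v : ((I.likelyMandatory d)ᶜ : Set V),
        (if T.x v = 0 then I.cost v * I.mandatoryProb v else 0) := by
    rw [← Finset.sum_sub_distrib]
    refine Finset.sum_congr rfl fun v _ => ?_
    rcases T.x_spec.half_integral v with h | h | h <;> simp only [h] <;> norm_num
    ring
  -- On `V_{1/2}` each vertex is charged `d c_v`, which covers `p_v c_v`; vertices of `VC'` pay the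
  -- remaining `(1 - d) c_v`.
  have e3 : ∑ v : ((I.likelyMandatory d)ᶜ : Set V),
        I.cost v * (if (v : V) ∈ T.firstStage then 1 else I.mandatoryProb v) ≤
      A + ∑ v : ((I.likelyMandatory d)ᶜ : Set V),
        (if T.x v = 0 then I.cost v * I.mandatoryProb v else 0) + d * B + (1 - d) * D := by
    rw [Finset.mul_sum, Finset.mul_sum, ← Finset.sum_add_distrib, ← Finset.sum_add_distrib,
      ← Finset.sum_add_distrib]
    refine Finset.sum_le_sum fun v _ => ?_
    have hc := I.cost_nonneg v
    have hcp := mul_le_mul_of_nonneg_left (hp v) hc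
    have hmem : (v : V) ∈ T.firstStage ↔ T.x v = 1 ∨ (v : V) ∈ T.halfCover := by
      rw [mem_firstStage]
      constructor
      · rintro (h | ⟨_, h⟩ | h)
        exacts [absurd h v.2, .inl h, .inr h]
      · rintro (h | h)
        exacts [.inr (.inl ⟨v.2, h⟩), .inr (.inr h)]
    have hhalf : (v : V) ∈ T.halfCover → T.x v = 1 / 2 := fun h => (T.half_of_mem_halfCover h).2
    simp only [hmem]
    by_cases hC : (v : V) ∈ T.halfCover
    · simp only [hC, hhalf hC]
      norm_num
      linarith
    · rcases T.x_spec.half_integral v with h | h | h <;> simp only [h, hC] <;> norm_num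
      linarith
  have hΦ : 0 ≤ Φ := Finset.sum_nonneg fun v _ => by
    split_ifs
    exacts [le_rfl, mul_nonneg (I.cost_nonneg v) (hf0 v)]
  rw [e2] at b2
  rw [e1]
  have h1 : d * A ≤ d * Φ := mul_le_mul_of_nonneg_left (by linarith) hd₀.le
  -- `b2` and `h1` give the factor `1 + d` on `Φ`; `h4` uses `α + (2 - α)d - (1 + d) = (α - 1)(1 -
  -- d)`.
  have h2 : d * B ≤ d * (2 * Ψ) := mul_le_mul_of_nonneg_left b3 hd₀.le
  have h3 : (1 - d) * D ≤ (1 - d) * (α * Ψ) := mul_le_mul_of_nonneg_left b4 (by linarith)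
  have h4 : 0 ≤ (α - 1) * (1 - d) * Φ :=
    mul_nonneg (mul_nonneg (by linarith) (by linarith)) hΦ
  nlinarith

theorem integral_totalCost_queried_le (hα₁ : 1 ≤ α) (hd₀ : 0 < d) (hd₁ : d ≤ 1) :
    ∫ w, I.totalCost (T.queried w) ∂I.law ≤
      max (1 / d) (α + (2 - α) * d) * ∫ w, I.opt w ∂I.law := by
  classical
  have hf0 : ∀ v, 0 ≤ I.optProb v := fun v =>
    (I.mandatoryProb_nonneg v).trans (I.mandatoryProb_le_optProb v)
  rw [T.integral_totalCost_queried, I.integral_opt,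
    ← sum_subtype_compl_add_sum_ite (I.likelyMandatory d),
    ← sum_subtype_compl_add_sum_ite (I.likelyMandatory d) fun v => I.cost v * I.optProb v, mul_add]
  refine add_le_add ((T.sum_compl_likelyMandatory_le hα₁ hd₀ hd₁).trans ?_) ?_
  · exact mul_le_mul_of_nonneg_right (le_max_right _ _)
      (Finset.sum_nonneg fun v _ => mul_nonneg (I.cost_nonneg v) (hf0 v))
  · rw [Finset.mul_sum]
    refine Finset.sum_le_sum fun v _ => ?_
    split_ifs with h h'
    · have h1 : 1 ≤ 1 / d * I.optProb v := by
        rw [one_div, ← div_eq_inv_mul, one_le_div hd₀]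
        exact le_trans h (I.mandatoryProb_le_optProb v)
      have h2 : 1 / d * I.optProb v ≤ max (1 / d) (α + (2 - α) * d) * I.optProb v :=
        mul_le_mul_of_nonneg_right (le_max_left _ _) (hf0 v)
      calc I.cost v * 1 ≤ I.cost v * (max (1 / d) (α + (2 - α) * d) * I.optProb v) :=
            mul_le_mul_of_nonneg_left (h1.trans h2) (I.cost_nonneg v)
        _ = _ := by ring
    · exact absurd (T.mem_firstStage.2 (.inl h)) h'
    · simp

end ThresholdRun

theorem thresholdCompetitiveRatio_le {α d : ℝ} (hα₁ : 1 ≤ α) (hd₀ : 0 < d) (hd₁ : d ≤ 1) :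
    thresholdCompetitiveRatio.{u} α d ≤ ENNReal.ofReal (max (1 / d) (α + (2 - α) * d)) := by
  refine iSup_le fun V => iSup_le fun _ => iSup_le fun I => iSup_le fun T => ?_
  refine ENNReal.div_le_of_le_mul ?_
  rw [← ENNReal.ofReal_mul (le_max_of_le_left (by positivity))]
  exact ENNReal.ofReal_le_ofReal (T.integral_totalCost_queried_le hα₁ hd₀ hd₁)

/-! ### The optimal parameter and the range of the ratio -/

section OptimalParameter

variable {α : ℝ}

theorem sq_sqrt_discriminant (α : ℝ) : √(8 - α * (4 - α)) ^ 2 = 4 + (2 - α) ^ 2 := by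
  rw [Real.sq_sqrt (by nlinarith [sq_nonneg (2 - α)])]
  ring

/-- A decreasing and a nondecreasing function have their smallest maximum where they cross. -/
theorem isMinOn_max_one_div {d : ℝ} (hα₂ : α ≤ 2)
    (heq : 1 / d = α + (2 - α) * d) :
    IsMinOn (fun t : ℝ => max (1 / t) (α + (2 - α) * t)) (Ioc 0 1) d := by
  intro t ht
  change max (1 / d) (α + (2 - α) * d) ≤ max (1 / t) (α + (2 - α) * t)
  rw [← heq, max_self]
  rcases le_total t d with h | h
  · exact le_max_of_le_left (one_div_le_one_div_of_le ht.1 h)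
  · refine le_max_of_le_right (heq.trans_le ?_)
    nlinarith

/-- `d` is the positive root of `(2 - α)d² + αd = 1`, with the root moved to the denominator so that
`α = 2` is no exception. -/
theorem optimal_parameter (hα₁ : 1 ≤ α) :
    let d := 2 / (α + √(8 - α * (4 - α)))
    d ∈ Ioc (0 : ℝ) 1 ∧ 1 / d = 1 / 2 * (α + √(8 - α * (4 - α))) ∧
      1 / d = α + (2 - α) * d := by
  intro d
  have hs := sq_sqrt_discriminant α
  have hs0 : 0 ≤ √(8 - α * (4 - α)) := Real.sqrt_nonneg _
  set s := √(8 - α * (4 - α))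
  have hs2 : 2 ≤ s := by nlinarith [sq_nonneg (2 - α)]
  have hpos : 0 < α + s := by linarith
  refine ⟨⟨by positivity, (div_le_one hpos).2 (by linarith)⟩, ?_, ?_⟩
  · rw [one_div_div]
    ring
  · simp only [d]
    field_simp
    nlinarith

theorem goldenRatio_le_ratio (hα₁ : 1 ≤ α) :
    Real.goldenRatio ≤ 1 / 2 * (α + √(8 - α * (4 - α))) := by
  have h5 : √5 ^ 2 = (5 : ℝ) := Real.sq_sqrt (by norm_num)
  have h51 : 1 ≤ √(5 : ℝ) := Real.one_le_sqrt.2 (by norm_num)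
  -- The squares differ by `2(α - 1)(√5 - 1)`.
  have : √5 + 1 - α ≤ √(8 - α * (4 - α)) := by
    apply Real.le_sqrt_of_sq_le
    nlinarith
  rw [Real.goldenRatio]
  linarith

theorem ratio_le_two (hα₂ : α ≤ 2) :
    1 / 2 * (α + √(8 - α * (4 - α))) ≤ 2 := by
  have : √(8 - α * (4 - α)) ≤ 4 - α := by
    rw [Real.sqrt_le_left (by linarith)]
    nlinarith
  linarith

end OptimalParameter

theorem theorem3p1 (α : ℝ) (hα₁ : 1 ≤ α) (hα₂ : α ≤ 2) :
    -- Threshold with an arbitrary parameter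
    (∀ d : ℝ, 0 < d → d ≤ 1 →
      (∀ (V : Type u) [Fintype V] (I : OrientationInstance V),
        Nonempty (ThresholdRun I α d) ∧
        Integrable I.opt I.law ∧
        ∀ T : ThresholdRun I α d,
          -- the algorithm solves the instance
          (∀ w, I.IsRealization w → I.Feasible w (T.queried w)) ∧
          -- the second stage depends only on the weights revealed in the first stage
          (∀ w w', I.IsRealization w → I.IsRealization w' →
            (∀ q ∈ T.firstStage, w q = w' q) → T.queried w = T.queried w') ∧
          Integrable (fun w => I.totalCost (T.queried w)) I.law ∧
          ∫ w, I.totalCost (T.queried w) ∂I.law ≤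
            max (1 / d) (α + (2 - α) * d) * ∫ w, I.opt w ∂I.law) ∧
      thresholdCompetitiveRatio.{u} α d ≤ ENNReal.ofReal (max (1 / d) (α + (2 - α) * d))) ∧
    -- the optimal choice of the parameter
    (∃ d ∈ Ioc (0 : ℝ) 1,
      d = 2 / (α + √(8 - α * (4 - α))) ∧
      IsMinOn (fun t : ℝ => max (1 / t) (α + (2 - α) * t)) (Ioc 0 1) d ∧
      max (1 / d) (α + (2 - α) * d) = 1 / 2 * (α + √(8 - α * (4 - α))) ∧
      thresholdCompetitiveRatio.{u} α d ≤
        ENNReal.ofReal (1 / 2 * (α + √(8 - α * (4 - α))))) ∧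
    -- the range of the resulting ratio
    Real.goldenRatio ≤ 1 / 2 * (α + √(8 - α * (4 - α))) ∧
    1 / 2 * (α + √(8 - α * (4 - α))) ≤ 2 ∧
    (α = 1 → 1 / 2 * (α + √(8 - α * (4 - α))) = Real.goldenRatio) ∧
    (α = 2 → 1 / 2 * (α + √(8 - α * (4 - α))) = 2) := by
  refine ⟨fun d hd₀ hd₁ => ⟨fun V _ I => ⟨ThresholdRun.nonempty I hα₁ d, I.integrable_opt,
    fun T => ⟨fun w hw => T.feasible_queried hw, fun w w' hw hw' h => T.queried_congr hw hw' h,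
      T.integrable_totalCost_queried, T.integral_totalCost_queried_le hα₁ hd₀ hd₁⟩⟩,
    thresholdCompetitiveRatio_le hα₁ hd₀ hd₁⟩, ?_, goldenRatio_le_ratio hα₁,
    ratio_le_two hα₂, ?_, ?_⟩
  · obtain ⟨hd, h1, h2⟩ := optimal_parameter hα₁
    have hmax : max (1 / (2 / (α + √(8 - α * (4 - α)))))
        (α + (2 - α) * (2 / (α + √(8 - α * (4 - α))))) = 1 / 2 * (α + √(8 - α * (4 - α))) := by
      rw [← h2, max_self, h1]
    refine ⟨_, hd, rfl, isMinOn_max_one_div hα₂ h2, hmax, ?_⟩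
    rw [← hmax]
    exact thresholdCompetitiveRatio_le hα₁ hd.1 hd.2
  · rintro rfl
    norm_num [Real.goldenRatio]
    ring
  · rintro rfl
    have : √(4 : ℝ) = 2 := by
      rw [show (4 : ℝ) = 2 ^ 2 by norm_num, Real.sqrt_sq (by norm_num)]
    norm_num [this]

end
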